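/- Let $V$ be a finite set with a metric $\mu$. For $x,y\in V$ put $I(x,y)=\{z\in V:\mu(x,z)+\mu(z,y)=\mu(x,y)\}$, and suppose that $\mu$ is *modular*: $I(x,y)\cap I(y,z)\cap I(x,z)\neq\varnothing$ for all $x,y,z\in V$. Let $H_\mu$ be the graph on $V$ in which distinct $x,y$ are adjacent iff $\mu(x,y)<\mu(x,z)+\mu(z,y)$ for all $z\in V\setminus\{x,y\}$, each edge $xy$ having weight $\mu(x,y)$. A *modular complex* $\Gamma$ is such a graph $H_\mu$ together with an orientation $\rightarrow$ of its edges such that for every 4-cycle $x_1,x_2,x_3,x_4$ of $H_\mu$, $x_1\rightarrow x_2$ implies $x_4\rightarrow x_3$. Write $p\preceq q$ if there is a directed path (possibly of length $0$) from $p$ to $q$ (in a modular complex this is a partial order), $[p,q]=\{x: p\preceq x\preceq q\}$, and let $\vee,\wedge$ denote the join and meet with respect to $\preceq$, where they exist. A relation $\sqsubseteq$ on $V$ is *admissible* if $p\sqsubseteq q$ implies $p\preceq q$; $p\sqsubseteq p$ for all $p$; $p\rightarrow q$ implies $p\sqsubseteq q$; and (a) if $p\sqsubseteq q$, $a\preceq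 b$ and $a,b\in[p,q]$, then $a\sqsubseteq b$; (b) if $p\sqsubseteq q_1$, $p\sqsubseteq q_2$ and $q_1\vee q_2$ exists, then $p\sqsubseteq q_1\vee q_2$; (c) if $p_1\sqsubseteq q$, $p_2\sqsubseteq q$ and $p_1\wedge p_2$ exists, then $p_1\wedge p_2\sqsubseteq q$. An *extended modular complex* is a modular complex $\Gamma$ together with an admissible relation $\sqsubseteq$. Its *thickening* $\Gamma^\diamond$ is the undirected unweighted graph on $V$ in which distinct $p,q$ are adjacent iff $p,q\in[a,b]$ for some $a,b\in V$ with $a\sqsubseteq b$; let $d^\diamond$ be its path metric. A set $U\subseteq V$ is *convex* if $I(x,y)\subseteq U$ for all $x,y\in U$, and *gated* if for every $v\in V$ there is a unique $v^*\in U$ such that $\mu(v,q)=\mu(v,v^*)+\mu(v^*,q)$ for all $q\in U$. **Theorem.** Let $\Gamma$ be an extended modular complex. For every $p\in V$ and every integer $k\ge 0$, the ball $\{q\in V: d^\diamond(p,q)\le k\}$ is convex, and it is gated. -/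

import Mathlib

/-! Finite metric spaces, their modularity and the graph they induce. -/

/-- The metric interval `I(x, y)`. -/
def metricInterval {V : Type*} [MetricSpace V] (x y : V) : Set V :=
  {z | dist x z + dist z y = dist x y}

/-- A metric is modular if every triple of points has a median. -/
def IsModularMetric (V : Type*) [MetricSpace V] : Prop :=
  ∀ x y z : V, (metricInterval x y ∩ metricInterval y z ∩ metricInterval x z).Nonempty

/-- The underlying graph of `H_μ`, the minimal graph (with edge weights the restriction of the
metric `μ`) whose path metric is `μ`: `x` and `y` are joined when no third point lies
between them. -/
def metricGraph (V : Type*) [MetricSpace V] : SimpleGraph V where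
  Adj x y := x ≠ y ∧ ∀ z, z ≠ x → z ≠ y → dist x y < dist x z + dist z y
  symm := ⟨by
    rintro x y ⟨hne, h⟩
    refine ⟨hne.symm, fun z hzy hzx => ?_⟩
    have := h z hzx hzy
    rw [dist_comm y x, dist_comm y z, dist_comm z x]
    linarith⟩
  loopless := ⟨fun _ h => h.1 rfl⟩

/-- A subset of a metric space is convex if it contains the metric interval between any two of
its points. -/
def IsMetricConvex {V : Type*} [MetricSpace V] (U : Set V) : Prop :=
  ∀ x ∈ U, ∀ y ∈ U, metricInterval x y ⊆ U

/-- A subset of a metric space is gated if every point has a unique gate at it. -/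
def IsGated {V : Type*} [MetricSpace V] (U : Set V) : Prop :=
  ∀ p : V, ∃! g : V, g ∈ U ∧ ∀ q ∈ U, dist p q = dist p g + dist g q

/-- A modular complex on the metric space `V` (taken finite below): the metric is modular, and
`arrow` is an admissible orientation of the graph `H_μ`, i.e. every edge gets exactly one of its
two directions, and opposite edges of every 4-cycle are directed in parallel. -/
structure ModularComplex (V : Type*) [MetricSpace V] where
  modular : IsModularMetric V
  arrow : V → V → Prop
  adj_iff : ∀ x y, (metricGraph V).Adj x y ↔ arrow x y ∨ arrow y x
  asymm : ∀ x y, arrow x y → ¬ arrow y x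
  parallel : ∀ x₁ x₂ x₃ x₄, x₁ ≠ x₃ → x₂ ≠ x₄ →
    (metricGraph V).Adj x₁ x₂ → (metricGraph V).Adj x₂ x₃ →
    (metricGraph V).Adj x₃ x₄ → (metricGraph V).Adj x₄ x₁ →
    arrow x₁ x₂ → arrow x₄ x₃

namespace ModularComplex

variable {V : Type*} [MetricSpace V] (Γ : ModularComplex V)

/-- The order `p ⪯ q` induced by the orientation: there is a directed path from `p` to `q`. -/
def le (p q : V) : Prop := Relation.ReflTransGen Γ.arrow p q

/-- The interval `[p, q]` of the induced order. -/
def orderInterval (p q : V) : Set V := {x | Γ.le p x ∧ Γ.le x q}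

/-- `s` is the join `a ∨ b`: the lowest common upper bound of `a` and `b`. -/
def IsJoin (a b s : V) : Prop :=
  Γ.le a s ∧ Γ.le b s ∧ ∀ u, Γ.le a u → Γ.le b u → Γ.le s u

/-- `s` is the meet `a ∧ b`: the greatest common lower bound of `a` and `b`. -/
def IsMeet (a b s : V) : Prop :=
  Γ.le s a ∧ Γ.le s b ∧ ∀ u, Γ.le u a → Γ.le u b → Γ.le u s

/-- Admissible relations `⊑` on a modular complex. -/
structure IsAdmissible (sq : V → V → Prop) : Prop where
  le_of_sq : ∀ p q, sq p q → Γ.le p q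
  refl : ∀ p, sq p p
  of_arrow : ∀ p q, Γ.arrow p q → sq p q
  mono : ∀ p q a b, sq p q → Γ.le a b →
    a ∈ Γ.orderInterval p q → b ∈ Γ.orderInterval p q → sq a b
  join : ∀ p q₁ q₂ s, sq p q₁ → sq p q₂ → Γ.IsJoin q₁ q₂ s → sq p s
  meet : ∀ p₁ p₂ q s, sq p₁ q → sq p₂ q → Γ.IsMeet p₁ p₂ s → sq s q

end ModularComplex

/-- An extended modular complex: a modular complex with an admissible relation `⊑`. -/
structure ExtendedModularComplex (V : Type*) [MetricSpace V] extends ModularComplex V where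
  sq : V → V → Prop
  admissible : toModularComplex.IsAdmissible sq

namespace ExtendedModularComplex

variable {V : Type*} [MetricSpace V] (Γ : ExtendedModularComplex V)

/-- `p` and `q` are `◇`-neighbors: `p, q ∈ [a, b]` for some `a ⊑ b`. -/
def DiamondNeighbors (p q : V) : Prop :=
  ∃ a b, Γ.sq a b ∧ p ∈ Γ.orderInterval a b ∧ q ∈ Γ.orderInterval a b

/-- The thickening `Γ^◇`: distinct nodes are joined when they are `◇`-neighbors. -/
def thickening : SimpleGraph V where
  Adj p q := p ≠ q ∧ Γ.DiamondNeighbors p q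
  symm := ⟨by
    rintro p q ⟨hne, a, b, h, hp, hq⟩
    exact ⟨hne.symm, a, b, h, hq, hp⟩⟩
  loopless := ⟨fun _ h => h.1 rfl⟩

/-- The ball of radius `k` around `p` for the path metric of the thickening. -/
def thickBall (p : V) (k : ℕ) : Set V := {q | Γ.thickening.edist p q ≤ k}

end ExtendedModularComplex

/-! A nonempty convex set in a finite modular space is gated: the nearest point is the gate, by
taking medians. So only convexity of balls is needed. The ball of radius `k + 1` is the set of
`◇`-neighbors of the ball of radius `k`, hence it suffices that the `◇`-neighborhood of a convex set
`U` is convex (`isMetricConvex_diamondNeighborhood`).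

By `IsModularMetric.isMetricConvex_of_local`, connectedness plus closure under midpoints `t` of
two-edge paths `x, t, y` is enough. Compare the gates of `x`, `t`, `y` in `U`. If the gate changes
along an edge at `t`, the edge and its gates form a rectangle ("ladder"), and `◇`-neighborhood is
transported along ladders (`DiamondNeighbors.of_isLadder`). If all three gates equal one point `u`,
the claim is local convexity around `u` (`DiamondNeighbors.of_adj_of_adj`), proved by cases on the
orientation of the two edges.

These steps use the order: its ideals, filters and intervals are convex, so joins and meets lie in
metric intervals, and the axioms for `⊑` apply to them. -/

section MetricModular

variable {V : Type*} [MetricSpace V]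

/-! ### Metric intervals, edges and gates in modular spaces. -/

theorem mem_metricInterval {x y z : V} :
    z ∈ metricInterval x y ↔ dist x z + dist z y = dist x y := Iff.rfl

theorem metricInterval_comm (x y : V) : metricInterval x y = metricInterval y x := by
  ext z
  rw [mem_metricInterval, mem_metricInterval, dist_comm x z, dist_comm z y, dist_comm x y, add_comm]

theorem right_mem_metricInterval (x y : V) : y ∈ metricInterval x y := by
  simp [mem_metricInterval]

theorem eq_of_mem_metricInterval_self {x z : V} (h : z ∈ metricInterval x x) : z = x := by
  rw [mem_metricInterval, dist_self, dist_comm z x] at h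
  exact (dist_le_zero.1 (by linarith [dist_nonneg (x := x) (y := z)])).symm

theorem metricInterval_subset {x y z : V} (h : z ∈ metricInterval x y) :
    metricInterval x z ⊆ metricInterval x y := by
  intro t ht
  rw [mem_metricInterval] at *
  linarith [dist_triangle t z y, dist_triangle x t y]

theorem mem_metricInterval_of_mem {x y z t : V} (h : z ∈ metricInterval x y)
    (ht : t ∈ metricInterval x z) : z ∈ metricInterval t y := by
  rw [mem_metricInterval] at *
  linarith [dist_triangle t z y, dist_triangle x t y]

theorem metricInterval_subset_right {x y z : V} (h : z ∈ metricInterval x y) :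
    metricInterval z y ⊆ metricInterval x y := by
  rw [metricInterval_comm z, metricInterval_comm x] at *
  exact metricInterval_subset h

theorem mem_metricInterval_of_mem_right {x y z t : V} (h : z ∈ metricInterval x y)
    (ht : t ∈ metricInterval z y) : z ∈ metricInterval x t := by
  rw [mem_metricInterval] at *
  linarith [dist_triangle x t y, dist_triangle x z t]

theorem eq_of_mem_metricInterval {x y z : V} (h : y ∈ metricInterval x z)
    (h' : z ∈ metricInterval x y) : y = z := by
  rw [mem_metricInterval, dist_comm z y] at *
  exact dist_le_zero.1 (by linarith)

theorem metricGraph_adj_iff {x y : V} :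
    (metricGraph V).Adj x y ↔ x ≠ y ∧ ∀ z ∈ metricInterval x y, z = x ∨ z = y := by
  refine and_congr_right fun _ => ⟨fun h z hz => ?_, fun h z hx hy => ?_⟩
  · by_contra! hc
    exact absurd (h z hc.1 hc.2) (by rw [mem_metricInterval.1 hz]; exact lt_irrefl _)
  · refine lt_of_le_of_ne (dist_triangle _ _ _) fun he => ?_
    rcases h z he.symm with h | h <;> contradiction

theorem IsModularMetric.exists_median (hV : IsModularMetric V) (x y z : V) :
    ∃ m, m ∈ metricInterval x y ∧ m ∈ metricInterval y z ∧ m ∈ metricInterval x z := by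
  obtain ⟨m, ⟨h1, h2⟩, h3⟩ := hV x y z
  exact ⟨m, h1, h2, h3⟩

/-- Any point sees one endpoint of an edge behind the other one. -/
theorem IsModularMetric.mem_or_mem_of_adj (hV : IsModularMetric V) {x y : V}
    (h : (metricGraph V).Adj x y) (z : V) : x ∈ metricInterval z y ∨ y ∈ metricInterval z x := by
  obtain ⟨m, h1, h2, h3⟩ := hV.exists_median x y z
  rcases (metricGraph_adj_iff.1 h).2 m h1 with rfl | rfl
  · left; rwa [metricInterval_comm]
  · right; rwa [metricInterval_comm]

theorem IsModularMetric.mem_of_adj_of_adj (hV : IsModularMetric V) {x y z : V}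
    (h : (metricGraph V).Adj x y) (h' : (metricGraph V).Adj x z) (hne : y ≠ z) :
    x ∈ metricInterval y z := by
  rcases hV.mem_or_mem_of_adj h z with h1 | h1
  · rwa [metricInterval_comm]
  · rw [metricInterval_comm] at h1
    rcases (metricGraph_adj_iff.1 h').2 y h1 with h2 | h2
    · exact absurd h2.symm h.ne
    · exact absurd h2 hne

/-- A convex nonempty subset of a finite modular metric space is gated. -/
theorem IsMetricConvex.isGated [Finite V] (hV : IsModularMetric V) {U : Set V}
    (hU : IsMetricConvex U) (hne : U.Nonempty) : IsGated U := by
  intro p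
  obtain ⟨g, hg, hmin⟩ := U.toFinite.exists_minimalFor (dist p) U hne
  refine ⟨g, ⟨hg, fun q hq => ?_⟩, fun g' hg' => ?_⟩
  -- The median lies in `U` by convexity and is no farther from `p` than `g`, so it is `g`.
  · obtain ⟨m, h1, h2, h3⟩ := hV.exists_median p g q
    have hm := hmin (hU g hg q hq h2)
    have h4 : dist m g ≤ 0 := by
      rw [mem_metricInterval] at h1
      by_contra! hc
      linarith [hm (by linarith)]
    obtain rfl : m = g := dist_le_zero.1 h4
    exact (mem_metricInterval.1 h3).symm
  · have h1 := hg'.2 g hg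
    have h2 := hmin hg'.1
    have h3 : dist g' g ≤ 0 := by
      by_contra! hc
      linarith [h2 (by linarith)]
    exact dist_le_zero.1 h3

theorem ncard_metricInterval_lt [Finite V] {x y z : V} (h : z ∈ metricInterval x y) (hne : z ≠ y) :
    (metricInterval x z).ncard < (metricInterval x y).ncard := by
  refine Set.ncard_lt_ncard ⟨metricInterval_subset h, fun hs => hne ?_⟩ (Set.toFinite _)
  exact eq_of_mem_metricInterval h (hs (right_mem_metricInterval x y))

theorem exists_adj_mem_metricInterval [Finite V] {x y : V} (hne : x ≠ y) :
    ∃ t ∈ metricInterval x y, (metricGraph V).Adj x t := by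
  obtain ⟨t, ht, hmin⟩ := (Set.toFinite (metricInterval x y \ {x})).exists_minimalFor (dist x) _
    ⟨y, right_mem_metricInterval x y, hne.symm⟩
  refine ⟨t, ht.1, metricGraph_adj_iff.2 ⟨fun h => ht.2 h.symm, fun z hz => ?_⟩⟩
  by_contra! hc
  have h1 := hmin (j := z) ⟨metricInterval_subset ht.1 hz, hc.1⟩
  rw [mem_metricInterval] at hz
  have h2 : 0 < dist z t := dist_pos.2 hc.2
  linarith [h1 (by linarith)]

/-! ### Ladders and the quadrangle condition. -/

/-- `x t` is an edge and `x, t, s, c` is a metric rectangle with sides parallel to `x t`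
and `x c`. -/
structure IsLadder (x t c s : V) : Prop where
  adj : (metricGraph V).Adj x t
  dist_rung : dist c s = dist x t
  dist_side : dist t s = dist x c
  dist_diag : dist x s = dist x c + dist x t
  dist_diag' : dist t c = dist x c + dist x t

namespace IsLadder

variable {x t c s : V}

theorem flip (h : IsLadder x t c s) : IsLadder t x s c where
  adj := h.adj.symm
  dist_rung := by rw [dist_comm s, dist_comm t, h.dist_rung]
  dist_side := h.dist_side.symm
  dist_diag := by rw [h.dist_diag', h.dist_side, dist_comm t x]
  dist_diag' := by rw [h.dist_diag, h.dist_side, dist_comm t x]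

theorem transverse (h : IsLadder x t c s) (hc : (metricGraph V).Adj x c) : IsLadder x c t s where
  adj := hc
  dist_rung := h.dist_side
  dist_side := h.dist_rung
  dist_diag := by rw [h.dist_diag, add_comm]
  dist_diag' := by rw [dist_comm, h.dist_diag', add_comm]

theorem adj_rung (hV : IsModularMetric V) (h : IsLadder x t c s) : (metricGraph V).Adj c s := by
  refine metricGraph_adj_iff.2 ⟨fun he => ?_, fun r hr => ?_⟩
  · have := h.dist_rung
    rw [he, dist_self] at this
    exact h.adj.ne (dist_eq_zero.1 this.symm)
  · obtain ⟨-, h1, h2, h3, h4⟩ := id h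
    rw [mem_metricInterval] at hr
    rcases hV.mem_or_mem_of_adj h.adj r with h5 | h5
    · left
      rw [mem_metricInterval] at h5
      have : dist c r ≤ 0 := by
        linarith [dist_triangle x r s, dist_triangle t r c, dist_triangle r s t, dist_comm r x,
          dist_comm r t, dist_comm r c, dist_comm s t]
      exact (dist_le_zero.1 this).symm
    · right
      rw [mem_metricInterval] at h5
      have : dist r s ≤ 0 := by
        linarith [dist_triangle x r s, dist_triangle t r c, dist_triangle r c x, dist_comm r x,
          dist_comm r t, dist_comm r c, dist_comm t x, dist_comm c x]
      exact dist_le_zero.1 this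

theorem symm (hV : IsModularMetric V) (h : IsLadder x t c s) : IsLadder c s x t where
  adj := h.adj_rung hV
  dist_rung := h.dist_rung.symm
  dist_side := by rw [dist_comm, h.dist_side, dist_comm]
  dist_diag := by rw [dist_comm, h.dist_diag', h.dist_rung, dist_comm c x]
  dist_diag' := by rw [dist_comm, h.dist_diag, h.dist_rung, dist_comm c x]

theorem mem_diag (h : IsLadder x t c s) : t ∈ metricInterval x s := by
  rw [mem_metricInterval]; linarith [h.dist_side, h.dist_diag]

/-- A ladder may be cut at any point of one of its sides. -/
theorem exists_split (hV : IsModularMetric V) (h : IsLadder x t c s) {r : V}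
    (hr : r ∈ metricInterval x c) :
    ∃ q ∈ metricInterval t s, IsLadder x t r q ∧ IsLadder r q c s := by
  obtain ⟨q, h1, h2, h3⟩ := hV.exists_median r t s
  obtain ⟨-, e1, e2, e3, e4⟩ := id h
  rw [mem_metricInterval] at h1 h3 hr
  have h2' := mem_metricInterval.1 h2
  have a1 : dist r s = dist r c + dist x t := by
    linarith [dist_triangle x r s, dist_triangle r c s]
  have a2 : dist r t = dist x r + dist x t := by
    linarith [dist_triangle t r c, dist_triangle r x t, dist_comm r t, dist_comm r x]
  have a3 : dist r q = dist x t := by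
    linarith [dist_comm q t]
  have a4 : dist t q = dist x r := by linarith [dist_comm q t]
  have a5 : dist q s = dist r c := by linarith
  have L : IsLadder x t r q := by
    refine ⟨h.adj, a3, a4, ?_, by rw [dist_comm, a2]⟩
    linarith [dist_triangle x q s, dist_triangle x r q]
  refine ⟨q, h2, L, L.adj_rung hV, by rw [e1, a3], a5, by rw [a1, a3], ?_⟩
  rw [a3]
  linarith [dist_triangle t q c, dist_triangle q r c, dist_comm q r]

end IsLadder

/-- The quadrangle condition. -/
theorem IsModularMetric.exists_isLadder (hV : IsModularMetric V) {x v y t : V}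
    (hy : (metricGraph V).Adj v y) (ht : (metricGraph V).Adj v t) (hne : y ≠ t)
    (hyx : y ∈ metricInterval x v) (htx : t ∈ metricInterval x v) :
    ∃ s, s ∈ metricInterval x y ∧ s ∈ metricInterval x t ∧ IsLadder v y t s := by
  obtain ⟨s, h1, h2, h3⟩ := hV.exists_median x y t
  have h4 := hV.mem_of_adj_of_adj hy ht hne
  refine ⟨s, h1, h3, ?_⟩
  rw [mem_metricInterval] at *
  have e1 := dist_comm y v
  have e2 := dist_comm t v
  have e3 := dist_comm s y
  have e4 := dist_comm s t
  refine ⟨hy, by linarith, by linarith, ?_, by linarith⟩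
  linarith [dist_triangle x s v, dist_triangle v y s, dist_comm s v]

/-- Gates of the two ends of an edge agree or form a translated edge. -/
theorem IsModularMetric.isLadder_gates (hV : IsModularMetric V) {U : Set V} {x t x' t' : V}
    (hxt : (metricGraph V).Adj x t) (hx' : x' ∈ U) (ht' : t' ∈ U)
    (hx : ∀ q ∈ U, dist x q = dist x x' + dist x' q)
    (ht : ∀ q ∈ U, dist t q = dist t t' + dist t' q) (hne : x' ≠ t') : IsLadder x t x' t' := by
  have h1 := hx t' ht'
  have h2 := ht x' hx'
  have e1 := dist_comm x' t'
  have e2 := dist_comm t x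
  have e3 := dist_comm t' x
  have e4 := dist_comm t' t
  have e5 := dist_comm x' t
  have e6 := dist_comm x' x
  have h0 : 0 < dist x' t' := dist_pos.2 hne
  -- Otherwise the route from `t` through `x` would make `x'` closer to `t` than its gate `t'`.
  have h3 := (hV.mem_or_mem_of_adj hxt t').resolve_left fun h => by
    rw [mem_metricInterval] at h
    linarith [dist_triangle t x x']
  have h4 := (hV.mem_or_mem_of_adj hxt x').resolve_right fun h => by
    rw [mem_metricInterval] at h
    linarith [dist_triangle x t t']
  rw [mem_metricInterval] at h3 h4
  exact ⟨hxt, by linarith, by linarith, by linarith, by linarith⟩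

/-! ### From local to global convexity. -/

theorem adj_chain_of_metricInterval_subset [Finite V] {W : Set V} {x y : V}
    (h : metricInterval x y ⊆ W) :
    Relation.ReflTransGen (fun a b => (metricGraph V).Adj a b ∧ b ∈ W) x y := by
  induction hn : (metricInterval x y).ncard using Nat.strong_induction_on generalizing y with
  | _ n ih =>
    subst hn
    by_cases hxy : x = y
    · subst hxy; exact .refl
    obtain ⟨t, ht, hadj⟩ := exists_adj_mem_metricInterval (Ne.symm hxy)
    rw [metricInterval_comm] at ht
    exact .tail (ih _ (ncard_metricInterval_lt ht hadj.ne') ((metricInterval_subset ht).trans h) rfl)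
      ⟨hadj.symm, h (right_mem_metricInterval x y)⟩

/-- Any neighbor `t` of `y'` towards `x`, other than `y`, completes a square `y', y, s, t` with `s`
in the interval from `x` to `y`. Then `t` is the midpoint of `s, t, y'`, hence in `W`, and the edge
`s t` reproduces the situation with a smaller interval. -/
theorem IsModularMetric.metricInterval_subset_of_adj [Finite V] (hV : IsModularMetric V)
    {W : Set V}
    (hloc : ∀ x ∈ W, ∀ y ∈ W, ∀ t, x ≠ y → (metricGraph V).Adj x t → (metricGraph V).Adj t y → t ∈ W)
    {x y y' : V} (hs : metricInterval x y ⊆ W) (hadj : (metricGraph V).Adj y y') (hy' : y' ∈ W)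
    (hm : y ∈ metricInterval x y') : metricInterval x y' ⊆ W := by
  induction hn : (metricInterval x y').ncard using Nat.strong_induction_on generalizing y y' with
  | _ n ih =>
    subst hn
    intro z hz
    by_cases hzy : y' = z
    · exact hzy ▸ hy'
    obtain ⟨t, ht, hadj'⟩ := exists_adj_mem_metricInterval hzy
    rw [metricInterval_comm] at ht
    have htx := metricInterval_subset_right hz ht
    have hzt := mem_metricInterval_of_mem_right hz ht
    by_cases hyt : y = t
    · exact hs (hyt ▸ hzt)
    obtain ⟨s, h1, h2, h3⟩ := hV.exists_isLadder hadj.symm hadj' hyt hm htx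
    have hts : (metricGraph V).Adj t s := h3.adj_rung hV
    have hsy : s ≠ y' := by
      rintro rfl
      exact hadj.ne (eq_of_mem_metricInterval hm h1)
    have htW : t ∈ W := hloc s (hs h1) y' hy' t hsy hts.symm hadj'.symm
    exact ih _ (ncard_metricInterval_lt htx hadj'.ne') ((metricInterval_subset h1).trans hs)
      hts.symm htW h2 rfl hzt

/-- In a finite modular metric space a connected set is convex as soon as it contains the midpoints
of all paths of two edges between distinct members. -/
theorem IsModularMetric.isMetricConvex_of_local [Finite V] (hV : IsModularMetric V) {W : Set V}
    (hconn : ∀ x ∈ W, ∀ y ∈ W,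
      Relation.ReflTransGen (fun a b => (metricGraph V).Adj a b ∧ b ∈ W) x y)
    (hloc : ∀ x ∈ W, ∀ y ∈ W, ∀ t, x ≠ y → (metricGraph V).Adj x t → (metricGraph V).Adj t y →
      t ∈ W) :
    IsMetricConvex W := by
  intro x hx y hy
  induction hconn x hx y hy with
  | refl =>
    intro z hz
    rwa [eq_of_mem_metricInterval_self hz]
  | @tail b c _ hbc ih =>
    have hxb : metricInterval x b ⊆ W := by
      by_cases hb : b ∈ W
      · exact ih hb
      · rename_i hch
        -- The chain up to `b` is either trivial or ends with a step into `W`, so `b ∈ W` in any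
        -- case.
        rcases Relation.ReflTransGen.cases_tail hch with h | ⟨d, -, h⟩
        · exact absurd (h ▸ hx) hb
        · exact absurd h.2 hb
    rcases hV.mem_or_mem_of_adj hbc.1 x with h | h
    · exact hV.metricInterval_subset_of_adj hloc hxb hbc.1 hbc.2 h
    · exact (metricInterval_subset h).trans hxb

theorem IsMetricConvex.inter {U W : Set V} (hU : IsMetricConvex U) (hW : IsMetricConvex W) :
    IsMetricConvex (U ∩ W) :=
  fun x hx y hy _ hz => ⟨hU x hx.1 y hy.1 hz, hW x hx.2 y hy.2 hz⟩

end MetricModular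

/-! ### Orientation, order and metric in a modular complex. -/

namespace ModularComplex

variable {V : Type*} [MetricSpace V] (Γ : ModularComplex V)

/-- The modular complex with all edges reversed. -/
def op : ModularComplex V where
  modular := Γ.modular
  arrow x y := Γ.arrow y x
  adj_iff x y := by rw [Γ.adj_iff, or_comm]
  asymm x y h := Γ.asymm y x h
  parallel x₁ x₂ x₃ x₄ h₁₃ h₂₄ h₁ h₂ h₃ h₄ h :=
    Γ.parallel x₂ x₁ x₄ x₃ h₂₄ h₁₃ h₁.symm h₄.symm h₃.symm h₂.symm h

theorem op_le {p q : V} : Γ.op.le p q ↔ Γ.le q p :=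
  Relation.reflTransGen_swap

theorem op_orderInterval (p q : V) : Γ.op.orderInterval p q = Γ.orderInterval q p := by
  ext x
  simp only [orderInterval, Set.mem_ofPred_eq, op_le, and_comm]

theorem op_isJoin {a b s : V} : Γ.op.IsJoin a b s ↔ Γ.IsMeet a b s := by
  simp only [IsJoin, IsMeet, op_le]

theorem op_isMeet {a b s : V} : Γ.op.IsMeet a b s ↔ Γ.IsJoin a b s := by
  simp only [IsJoin, IsMeet, op_le]

variable {Γ}

theorem adj_of_arrow {p q : V} (h : Γ.arrow p q) : (metricGraph V).Adj p q :=
  (Γ.adj_iff p q).2 (.inl h)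

theorem le_refl (p : V) : Γ.le p p := .refl

theorem le_of_arrow {p q : V} (h : Γ.arrow p q) : Γ.le p q := .single h

theorem le.trans {p q r : V} (h : Γ.le p q) (h' : Γ.le q r) : Γ.le p r :=
  Relation.ReflTransGen.trans h h'

theorem arrow_of_isLadder_of_adj {x t c s : V} (h : IsLadder x t c s)
    (hc : (metricGraph V).Adj x c) (hxt : Γ.arrow x t) : Γ.arrow c s := by
  have hV := Γ.modular
  have hts := (h.transverse hc).adj_rung hV
  have h0 : 0 < dist x t := dist_pos.2 h.adj.ne
  have h1 := dist_nonneg (x := x) (y := c)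
  refine Γ.parallel x t s c ?_ ?_ h.adj hts (h.adj_rung hV).symm hc.symm hxt
  · rintro rfl
    have := h.dist_diag
    rw [dist_self] at this
    linarith
  · rintro rfl
    have := h.dist_diag'
    rw [dist_self] at this
    linarith

/-- Opposite rungs of a ladder are directed in parallel. -/
theorem arrow_of_isLadder [Finite V] {x t c s : V} (h : IsLadder x t c s)
    (hxt : Γ.arrow x t) : Γ.arrow c s := by
  induction hn : (metricInterval c x).ncard using Nat.strong_induction_on generalizing x t with
  | _ n ih =>
    subst hn
    by_cases hxc : x = c
    · subst hxc
      obtain rfl : t = s := dist_eq_zero.1 (by rw [h.dist_side, dist_self])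
      exact hxt
    obtain ⟨x₁, hx₁, hadj⟩ := exists_adj_mem_metricInterval hxc
    obtain ⟨t₁, -, h1, h2⟩ := h.exists_split Γ.modular hx₁
    rw [metricInterval_comm] at hx₁
    exact ih _ (ncard_metricInterval_lt hx₁ hadj.ne') h2 (arrow_of_isLadder_of_adj h1 hadj hxt) rfl

/-- Extending a directed path by `q → r` cannot turn back towards `p`, since induction would orient
the edge as `r → q`. A second neighbor `t` of `r` towards `p` spans a square with `q`, whose lower
corner `s` satisfies `s → q` by induction; parallel edges give `t → r` and `s → t`. -/
theorem arrow_of_le_of_mem_aux [Finite V] {p q : V} (h : Γ.le p q) :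
    ∀ t ∈ metricInterval p q, (metricGraph V).Adj t q → Γ.arrow t q ∧ Γ.le p t := by
  have hV := Γ.modular
  induction h with
  | refl =>
    intro t ht hadj
    exact absurd (eq_of_mem_metricInterval_self ht) hadj.ne
  | @tail q r hpq hqr ih =>
    intro t ht hadj
    by_cases htq : q = t
    · exact htq ▸ ⟨hqr, hpq⟩
    have hqm : q ∈ metricInterval p r := by
      refine (hV.mem_or_mem_of_adj (adj_of_arrow hqr) p).resolve_right fun hr => ?_
      exact Γ.asymm _ _ hqr (ih r hr (adj_of_arrow hqr).symm).1
    obtain ⟨s, h1, h2, h3⟩ :=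
      hV.exists_isLadder (adj_of_arrow hqr).symm hadj.symm htq hqm ht
    have h4 := h3.transverse hadj.symm
    have h5 := ih s h1 (h4.adj_rung hV).symm
    exact ⟨arrow_of_isLadder (h4.symm hV).flip h5.1,
      h5.2.trans (le_of_arrow (arrow_of_isLadder h3.flip hqr))⟩

theorem arrow_of_le_of_mem [Finite V] {p q t : V} (h : Γ.le p q) (ht : t ∈ metricInterval p q)
    (hadj : (metricGraph V).Adj t q) : Γ.arrow t q :=
  (arrow_of_le_of_mem_aux h t ht hadj).1

theorem le_and_le_of_mem [Finite V] {p q t : V} (h : Γ.le p q) (ht : t ∈ metricInterval p q) :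
    Γ.le p t ∧ Γ.le t q := by
  induction hn : (metricInterval p q).ncard using Nat.strong_induction_on generalizing q with
  | _ n ih =>
    subst hn
    by_cases hqt : q = t
    · exact hqt ▸ ⟨h, le_refl _⟩
    obtain ⟨s, hs, hadj⟩ := exists_adj_mem_metricInterval hqt
    rw [metricInterval_comm] at hs
    have hsp := metricInterval_subset_right ht hs
    have h1 := arrow_of_le_of_mem_aux h s hsp hadj.symm
    have h2 := ih _ (ncard_metricInterval_lt hsp hadj.ne') h1.2
      (mem_metricInterval_of_mem_right ht hs) rfl
    exact ⟨h2.1, h2.2.trans (le_of_arrow h1.1)⟩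

theorem mem_of_le_of_arrow [Finite V] {p q r : V} (h : Γ.le p q) (hqr : Γ.arrow q r) :
    q ∈ metricInterval p r :=
  (Γ.modular.mem_or_mem_of_adj (adj_of_arrow hqr) p).resolve_right fun hr =>
    Γ.asymm _ _ hqr (arrow_of_le_of_mem h hr (adj_of_arrow hqr).symm)

theorem mem_of_le_of_le [Finite V] {p q r : V} (h : Γ.le p q) (hqr : Γ.le q r) :
    q ∈ metricInterval p r := by
  induction hqr with
  | refl => exact right_mem_metricInterval _ _
  | @tail a b hqa hab ih =>
    exact metricInterval_subset (mem_of_le_of_arrow (le.trans h hqa) hab) ih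

theorem le_antisymm [Finite V] {p q : V} (h : Γ.le p q) (h' : Γ.le q p) : p = q :=
  (eq_of_mem_metricInterval_self (mem_of_le_of_le h h')).symm

theorem ne_of_arrow {p q : V} (h : Γ.arrow p q) : p ≠ q := (adj_of_arrow h).ne

/-- An upper bound of two distinct lower neighbors of `t` lies above `t`. -/
theorem le_of_arrow_of_arrow [Finite V] {x y t u : V} (hne : x ≠ y) (hx : Γ.arrow x t)
    (hy : Γ.arrow y t) (hxu : Γ.le x u) (hyu : Γ.le y u) : Γ.le t u := by
  have hV := Γ.modular
  obtain ⟨m, h1, h2, h3⟩ := hV.exists_median x y u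
  obtain ⟨hxm, -⟩ := le_and_le_of_mem hxu h3
  obtain ⟨hym, hmu⟩ := le_and_le_of_mem hyu h2
  have key : ∀ {x y : V}, x ≠ y → Γ.arrow x t → Γ.arrow y t → ¬ Γ.le x y := by
    intro x y hne hx hy hxy
    have := mem_of_le_of_arrow hxy hy
    rcases (metricGraph_adj_iff.1 (adj_of_arrow hx)).2 y this with h | h
    · exact hne h.symm
    · exact ne_of_arrow hy h
  have hxm' : x ≠ m := by rintro rfl; exact key hne.symm hy hx hym
  have hym' : m ≠ y := by rintro rfl; exact key hne hx hy hxm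
  have htm := hV.mem_of_adj_of_adj (adj_of_arrow hx).symm (adj_of_arrow hy).symm hne
  by_cases htm' : m = t
  · exact htm' ▸ hmu
  exfalso
  -- If the median `m` is not `t`, a first step `x₁` from `x` towards `m` gives a square `x, t, y,
  -- x₁`. Then `x₁ → y` is parallel to `x → t`, and `m` must be an end of this edge, although `m`
  -- lies strictly above `y`.
  obtain ⟨x₁, hx₁, hadj⟩ := exists_adj_mem_metricInterval hxm'
  have hx₁' := metricInterval_subset h1 hx₁
  have hmx₁ := mem_metricInterval_of_mem h1 hx₁
  by_cases hx₁t : x₁ = t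
  · rw [hx₁t] at hmx₁
    rcases (metricGraph_adj_iff.1 (adj_of_arrow hy).symm).2 m hmx₁ with h | h
    · exact htm' h
    · exact hym' h
  rw [metricInterval_comm] at hx₁' htm
  obtain ⟨s, h4, h5, h6⟩ := hV.exists_isLadder hadj (adj_of_arrow hx) hx₁t hx₁' htm
  rw [metricInterval_comm] at h5
  rcases (metricGraph_adj_iff.1 (adj_of_arrow hy).symm).2 s h5 with h | h
  · exact (h6.adj_rung hV).ne h.symm
  subst h
  have h7 := h6.transverse (adj_of_arrow hx)
  have h8 := arrow_of_isLadder h7 hx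
  rcases (metricGraph_adj_iff.1 (adj_of_arrow h8)).2 m hmx₁ with h | h
  · subst h
    exact ne_of_arrow h8 (le_antisymm (le_of_arrow h8) hym)
  · exact hym' h

/-! ### Convexity of order ideals; joins and meets as medians. -/

theorem isMetricConvex_Iic [Finite V] (u : V) : IsMetricConvex {z | Γ.le z u} := by
  have hV := Γ.modular
  refine hV.isMetricConvex_of_local (fun x hx y hy => ?_) fun x hx y hy t hne hxt hty => ?_
  · refine .trans (adj_chain_of_metricInterval_subset (y := u) fun z hz => ?_)
      (adj_chain_of_metricInterval_subset (y := y) fun z hz => ?_)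
    · exact (le_and_le_of_mem hx hz).2
    · rw [metricInterval_comm] at hz
      exact (le_and_le_of_mem hy hz).2
  · rcases (Γ.adj_iff x t).1 hxt with h | h
    · rcases (Γ.adj_iff t y).1 hty with h' | h'
      · exact (le_of_arrow h').trans hy
      · exact le_of_arrow_of_arrow hne h h' hx hy
    · exact (le_of_arrow h).trans hx

theorem isMetricConvex_Ici [Finite V] (u : V) : IsMetricConvex {z | Γ.le u z} := by
  have := isMetricConvex_Iic (Γ := Γ.op) u
  simpa only [op_le] using this

theorem isMetricConvex_orderInterval [Finite V] (p q : V) :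
    IsMetricConvex (Γ.orderInterval p q) :=
  (isMetricConvex_Ici p).inter (isMetricConvex_Iic q)

theorem IsJoin.unique [Finite V] {a b s s' : V} (h : Γ.IsJoin a b s) (h' : Γ.IsJoin a b s') :
    s = s' :=
  le_antisymm (h.2.2 s' h'.1 h'.2.1) (h'.2.2 s h.1 h.2.1)

theorem isJoin_of_mem [Finite V] {a b s : V} (ha : Γ.le a s) (hb : Γ.le b s)
    (hs : s ∈ metricInterval a b) : Γ.IsJoin a b s :=
  ⟨ha, hb, fun u hau hbu => isMetricConvex_Iic u a hau b hbu hs⟩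

theorem exists_isJoin [Finite V] {a b u : V} (ha : Γ.le a u) (hb : Γ.le b u) :
    ∃ s, Γ.IsJoin a b s := by
  obtain ⟨m, h1, h2, h3⟩ := Γ.modular.exists_median a b u
  exact ⟨m, isJoin_of_mem (le_and_le_of_mem ha h3).1 (le_and_le_of_mem hb h2).1 h1⟩

theorem exists_isMeet [Finite V] {a b u : V} (ha : Γ.le u a) (hb : Γ.le u b) :
    ∃ s, Γ.IsMeet a b s := by
  have := exists_isJoin (Γ := Γ.op) (Γ.op_le.2 ha) (Γ.op_le.2 hb)
  simpa only [op_isJoin] using this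

theorem IsJoin.mem_metricInterval [Finite V] {a b s : V} (h : Γ.IsJoin a b s) :
    s ∈ metricInterval a b := by
  obtain ⟨m, h1, h2, h3⟩ := Γ.modular.exists_median a b s
  have := isJoin_of_mem (le_and_le_of_mem h.1 h3).1 (le_and_le_of_mem h.2.1 h2).1 h1
  rwa [h.unique this]

theorem IsMeet.mem_metricInterval [Finite V] {a b s : V} (h : Γ.IsMeet a b s) :
    s ∈ metricInterval a b :=
  IsJoin.mem_metricInterval (Γ.op_isJoin.2 h)

/-- Directed paths are transported along ladders. -/
theorem le_of_isLadder [Finite V] {x t c s : V} (hxc : Γ.le x c) (h : IsLadder x t c s) :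
    Γ.le t s := by
  induction hxc generalizing s with
  | refl =>
    obtain rfl : t = s := dist_eq_zero.1 (by rw [h.dist_side, dist_self])
    exact le_refl _
  | @tail q r hxq hqr ih =>
    obtain ⟨q', -, h1, h2⟩ := h.exists_split Γ.modular (mem_of_le_of_arrow hxq hqr)
    exact (ih h1).trans (le_of_arrow (arrow_of_isLadder (h2.transverse (adj_of_arrow hqr)) hqr))

/-- In the order interval above `w`, the join with an upper neighbor `x` of `w` is a translate
of `w x`. -/
theorem isLadder_of_isJoin [Finite V] {w x e b : V}
    (hwx : Γ.arrow w x) (hwe : Γ.le w e) (hw : w ∈ metricInterval x e) (hb : Γ.IsJoin x e b) :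
    IsLadder w x e b := by
  have h1 := hb.mem_metricInterval
  have h2 := mem_of_le_of_le (le_of_arrow hwx) hb.1
  have h3 := mem_of_le_of_le hwe hb.2.1
  rw [mem_metricInterval] at *
  have e1 := dist_comm x w
  have e2 := dist_comm b e
  exact ⟨adj_of_arrow hwx, by linarith, by linarith, by linarith, by linarith⟩

/-- If `w x y t` is a square with bottom `w`, and `w` lies between `t` and `e`, then the translates
`b₁` and `b₂` of `x` and `y` to the upper neighbors of `e` have an upper bound. -/
theorem exists_upper_bound [Finite V] {w x y t e b₁ b₂ : V}
    (hsq : IsLadder w x y t) (hwx : Γ.arrow w x) (hwy : Γ.arrow w y)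
    (hne : b₁ ≠ b₂) (hwt : w ∈ metricInterval t e)
    (h₁ : IsLadder w x e b₁) (h₂ : IsLadder w y e b₂) : ∃ m, Γ.le b₁ m ∧ Γ.le b₂ m := by
  have hV := Γ.modular
  have a₁ := arrow_of_isLadder h₁ hwx
  have a₂ := arrow_of_isLadder h₂ hwy
  have h3 := hV.mem_of_adj_of_adj (adj_of_arrow a₁) (adj_of_arrow a₂) hne
  -- Both `b₁` and `b₂` are nearer to `t` than `e`, so this is the quadrangle condition at `e`: the
  -- median closes a square above `e`.
  obtain ⟨m, m1, m2, m3⟩ := hV.exists_median t b₁ b₂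
  obtain ⟨-, s1, s2, s3, s4⟩ := hsq
  obtain ⟨-, p1, p2, p3, p4⟩ := id h₁
  obtain ⟨-, q1, q2, q3, q4⟩ := id h₂
  rw [mem_metricInterval] at *
  have e1 := dist_comm t w
  have e2 := dist_comm t x
  have e3 := dist_comm t y
  have e4 := dist_comm b₁ e
  have e5 := dist_comm b₂ e
  have e6 := dist_comm m b₁
  have e7 := dist_comm m b₂
  have e8 := dist_comm m e
  have d1 : dist t b₁ = dist w y + dist w e := by
    linarith [dist_triangle t b₁ e, dist_triangle t x b₁]
  have d2 : dist t b₂ = dist w x + dist w e := by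
    linarith [dist_triangle t b₂ e, dist_triangle t y b₂]
  have hl : IsLadder e b₁ b₂ m := by
    refine ⟨adj_of_arrow a₁, by linarith, by linarith, ?_, by linarith⟩
    linarith [dist_triangle t m e, dist_triangle e b₁ m]
  exact ⟨m, le_of_arrow (arrow_of_isLadder (hl.transverse (adj_of_arrow a₂)) a₂),
    le_of_arrow (arrow_of_isLadder hl a₁)⟩

end ModularComplex

/-! ### Transport and local convexity of `◇`-neighbors. -/

namespace ExtendedModularComplex

open ModularComplex

variable {V : Type*} [MetricSpace V] (Γ : ExtendedModularComplex V)

/-- The extended modular complex with all edges and the relation `⊑` reversed. -/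
def op : ExtendedModularComplex V where
  toModularComplex := Γ.toModularComplex.op
  sq p q := Γ.sq q p
  admissible := by
    obtain ⟨h1, h2, h3, h4, h5, h6⟩ := Γ.admissible
    refine ⟨fun p q h => (op_le _).2 (h1 q p h), h2, fun p q h => h3 q p h, ?_, ?_, ?_⟩
    · intro p q a b h hab ha hb
      rw [op_orderInterval] at ha hb
      exact h4 q p b a h ((op_le _).1 hab) hb ha
    · intro p q₁ q₂ s h h' hs
      exact h6 q₁ q₂ p s h h' ((op_isJoin _).1 hs)
    · intro p₁ p₂ q s h h' hs
      exact h5 q p₁ p₂ s h h' ((op_isMeet _).1 hs)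

theorem op_diamondNeighbors {p q : V} : Γ.op.DiamondNeighbors p q ↔ Γ.DiamondNeighbors p q := by
  have h : ∀ a b, Γ.op.orderInterval a b = Γ.orderInterval b a := op_orderInterval _
  simp only [DiamondNeighbors, h]
  exact ⟨fun ⟨a, b, h⟩ => ⟨b, a, h⟩, fun ⟨a, b, h⟩ => ⟨b, a, h⟩⟩

variable {Γ}

theorem diamondNeighbors_of_sq {a b p q : V} (h : Γ.sq a b) (hap : Γ.le a p) (hpb : Γ.le p b)
    (haq : Γ.le a q) (hqb : Γ.le q b) : Γ.DiamondNeighbors p q :=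
  ⟨a, b, h, ⟨hap, hpb⟩, ⟨haq, hqb⟩⟩

theorem sq_of_le_of_le {p q a b : V} (h : Γ.sq p q) (hpa : Γ.le p a) (hab : Γ.le a b)
    (hbq : Γ.le b q) : Γ.sq a b :=
  Γ.admissible.mono p q a b h hab ⟨hpa, hab.trans hbq⟩ ⟨hpa.trans hab, hbq⟩

namespace DiamondNeighbors

theorem refl (p : V) : Γ.DiamondNeighbors p p :=
  diamondNeighbors_of_sq (Γ.admissible.refl p) (le_refl _) (le_refl _) (le_refl _) (le_refl _)

theorem symm {p q : V} (h : Γ.DiamondNeighbors p q) : Γ.DiamondNeighbors q p := by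
  obtain ⟨a, b, h, hp, hq⟩ := h
  exact ⟨a, b, h, hq, hp⟩

variable [Finite V]

theorem of_mem {p q z : V} (h : Γ.DiamondNeighbors p q) (hz : z ∈ metricInterval p q) :
    Γ.DiamondNeighbors z q := by
  obtain ⟨a, b, h, hp, hq⟩ := h
  exact ⟨a, b, h, isMetricConvex_orderInterval a b p hp q hq hz, hq⟩

theorem exists_sq {p q : V} (h : Γ.DiamondNeighbors p q) :
    ∃ m j, Γ.IsMeet p q m ∧ Γ.IsJoin p q j ∧ Γ.sq m j := by
  obtain ⟨a, b, h, hp, hq⟩ := h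
  obtain ⟨m, hm⟩ := exists_isMeet hp.1 hq.1
  obtain ⟨j, hj⟩ := exists_isJoin hp.2 hq.2
  exact ⟨m, j, hm, hj, sq_of_le_of_le h (hm.2.2 a hp.1 hq.1) (hm.1.trans hj.1)
    (hj.2.2 b hp.2 hq.2)⟩

/-- The meet `a` and the join `b` of `x, x'` lie on the side of the ladder, so they have translates
`a → a'` and `b → b'`. Since `b'` is the join of `b` and `a'`, axiom (b) gives `a ⊑ b'`, and `[a,
b']` contains `t` and `t'`. -/
theorem of_isLadder_of_arrow {x t x' t' : V} (h : Γ.DiamondNeighbors x x')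
    (hl : IsLadder x t x' t') (hxt : Γ.arrow x t) : Γ.DiamondNeighbors t t' := by
  have hV := Γ.modular
  obtain ⟨a, b, ha, hb, hab⟩ := h.exists_sq
  obtain ⟨a', -, ha1, -⟩ := hl.exists_split hV ha.mem_metricInterval
  obtain ⟨b', hb', hb1, hb2⟩ := hl.exists_split hV hb.mem_metricInterval
  have haa' : Γ.arrow a a' := arrow_of_isLadder ha1 hxt
  have hbb' : Γ.arrow b b' := arrow_of_isLadder hb1 hxt
  have htb' : Γ.le t b' := le_of_isLadder hb.1 hb1
  have htb2 : Γ.le t' b' := le_of_isLadder hb.2.1 (hb2.symm hV)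
  have ha't : Γ.le a' t := le_of_isLadder ha.1 (ha1.symm hV)
  have hj : Γ.IsJoin b a' b' := by
    refine ⟨le_of_arrow hbb', ha't.trans htb', fun u hbu hau => ?_⟩
    have htu : Γ.le t u := isMetricConvex_Iic u x (hb.1.trans hbu) a' hau ha1.mem_diag
    have htu' : Γ.le t' u :=
      isMetricConvex_Iic u x' (hb.2.1.trans hbu) t htu (hl.symm hV).mem_diag
    exact isMetricConvex_Iic u t htu t' htu' hb'
  have hab' : Γ.sq a b' :=
    Γ.admissible.join a b a' b' hab (Γ.admissible.of_arrow _ _ haa') hj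
  exact diamondNeighbors_of_sq hab' ((le_of_arrow haa').trans ha't) htb'
    (ha.2.1.trans (le_of_arrow (arrow_of_isLadder hl hxt))) htb2

/-- Being `◇`-neighbors is invariant under translation along an edge. -/
theorem of_isLadder {x t x' t' : V} (h : Γ.DiamondNeighbors x x')
    (hl : IsLadder x t x' t') : Γ.DiamondNeighbors t t' := by
  rcases (Γ.adj_iff x t).1 hl.adj with hxt | hxt
  · exact h.of_isLadder_of_arrow hl hxt
  · have := of_isLadder_of_arrow (Γ := Γ.op) (Γ.op_diamondNeighbors.2 h) hl hxt
    exact Γ.op_diamondNeighbors.1 this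

theorem sq_isJoin_of_arrow {x t u b : V} (h : Γ.DiamondNeighbors x u) (hxt : Γ.arrow x t)
    (hb : Γ.IsJoin t u b) : Γ.sq t b := by
  obtain ⟨a₁, b₁, ha₁, hb₁, hab₁⟩ := h.exists_sq
  have hx : Γ.sq x b₁ := sq_of_le_of_le hab₁ ha₁.1 hb₁.1 (le_refl _)
  have hxb : Γ.le x b := (le_of_arrow hxt).trans hb.1
  have hj : Γ.IsJoin b₁ t b :=
    ⟨hb₁.2.2 b hxb hb.2.1, hb.1, fun v hv hv' => hb.2.2 v hv' (hb₁.2.1.trans hv)⟩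
  exact sq_of_le_of_le (Γ.admissible.join x b₁ t b hx (Γ.admissible.of_arrow _ _ hxt) hj)
    (le_of_arrow hxt) hb.1 (le_refl _)

/-- The common lower bound `c` makes the meet of `t` and `u` exist, so axiom (c) applies. -/
theorem of_sq_of_sq {t u c b : V} (hct : Γ.le c t) (hcu : Γ.le c u) (ht : Γ.sq t b)
    (hu : Γ.sq u b) : Γ.DiamondNeighbors t u := by
  obtain ⟨a, ha⟩ := exists_isMeet hct hcu
  exact diamondNeighbors_of_sq (Γ.admissible.meet t u b a ht hu ha) ha.1
    (Γ.admissible.le_of_sq _ _ ht) ha.2.1 (Γ.admissible.le_of_sq _ _ hu)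

theorem of_arrow_of_arrow {x y t u : V} (hx : Γ.DiamondNeighbors x u)
    (hy : Γ.DiamondNeighbors y u) (hxt : Γ.arrow x t) (hty : Γ.arrow t y) :
    Γ.DiamondNeighbors t u := by
  obtain ⟨a₁, b₁, ha₁, hb₁, hab₁⟩ := hx.exists_sq
  obtain ⟨a₂, b₂, ha₂, hb₂, hab₂⟩ := hy.exists_sq
  have htb₂ : Γ.le t b₂ := (le_of_arrow hty).trans hb₂.1
  obtain ⟨b, hb⟩ := exists_isJoin htb₂ hb₂.2.1
  exact of_sq_of_sq (ha₁.1.trans (le_of_arrow hxt)) ha₁.2.1 (hx.sq_isJoin_of_arrow hxt hb)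
    (sq_of_le_of_le hab₂ ha₂.2.1 hb.2.1 (hb.2.2 b₂ htb₂ hb₂.2.1))

/-- The target is `b = t ∨ u`, with `t ⊑ b` and `u ⊑ b`. For the latter, `b` is also the join of `b₁
= x ∨ u` and `b₂ = y ∨ u`, so axiom (b) applies once `b₁` and `b₂` have an upper bound. That bound
comes from the square `w, x, t, y`: over `e = w ∨ u`, the points `b₁` and `b₂` are translates of `x`
and `y`. -/
theorem of_arrow_to {x y t u : V} (hx : Γ.DiamondNeighbors x u)
    (hy : Γ.DiamondNeighbors y u) (hne : x ≠ y) (hxt : Γ.arrow x t) (hyt : Γ.arrow y t)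
    (hxu : x ∈ metricInterval u t) (hyu : y ∈ metricInterval u t) : Γ.DiamondNeighbors t u := by
  have hV := Γ.modular
  obtain ⟨a₁, b₁, ha₁, hb₁, hab₁⟩ := hx.exists_sq
  obtain ⟨a₂, b₂, ha₂, hb₂, hab₂⟩ := hy.exists_sq
  obtain ⟨w, hw1, hw2, hl⟩ :=
    hV.exists_isLadder (adj_of_arrow hxt).symm (adj_of_arrow hyt).symm hne hxu hyu
  have hwx : Γ.arrow w x := arrow_of_isLadder (hl.transverse (adj_of_arrow hyt).symm).flip hyt
  have hwy : Γ.arrow w y := arrow_of_isLadder hl.flip hxt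
  have hsq : IsLadder w x y t := (hl.symm hV).flip.transverse (adj_of_arrow hwx)
  have hwt := metricInterval_subset hxu hw1
  obtain ⟨m, hm₁, hm₂⟩ : ∃ m, Γ.le b₁ m ∧ Γ.le b₂ m := by
    by_cases hb : b₁ = b₂
    · exact ⟨b₂, hb ▸ le_refl _, le_refl _⟩
    obtain ⟨e, he⟩ := exists_isJoin ((le_of_arrow hwx).trans hb₁.1) hb₁.2.1
    have hem := he.mem_metricInterval
    rw [metricInterval_comm] at hem
    have key : ∀ {z b}, Γ.arrow w z → w ∈ metricInterval u z → Γ.IsJoin z u b →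
        IsLadder w z e b := by
      intro z b hwz hw hb
      have h1 := mem_metricInterval_of_mem hw hem
      rw [metricInterval_comm] at h1
      refine isLadder_of_isJoin hwz he.1 h1 ⟨hb.1, ?_, fun v hv hv' => hb.2.2 v hv ?_⟩
      · exact he.2.2 b ((le_of_arrow hwz).trans hb.1) hb.2.1
      · exact he.2.1.trans hv'
    have hwe := mem_metricInterval_of_mem hwt hem
    rw [metricInterval_comm] at hwe
    exact exists_upper_bound hsq hwx hwy hb hwe (key hwx hw1 hb₁) (key hwy hw2 hb₂)
  have hupper : ∀ v, Γ.le b₁ v → Γ.le b₂ v → Γ.le t v := fun v h h' =>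
    le_of_arrow_of_arrow hne hxt hyt (hb₁.1.trans h) (hb₂.1.trans h')
  obtain ⟨b, hb⟩ := exists_isJoin (hupper m hm₁ hm₂) (hb₁.2.1.trans hm₁)
  have hj : Γ.IsJoin b₁ b₂ b :=
    ⟨hb₁.2.2 b ((le_of_arrow hxt).trans hb.1) hb.2.1,
      hb₂.2.2 b ((le_of_arrow hyt).trans hb.1) hb.2.1,
      fun v h h' => hb.2.2 v (hupper v h h') (hb₁.2.1.trans h)⟩
  have hu : Γ.sq u b := Γ.admissible.join u b₁ b₂ b
    (sq_of_le_of_le hab₁ ha₁.2.1 hb₁.2.1 (le_refl _))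
    (sq_of_le_of_le hab₂ ha₂.2.1 hb₂.2.1 (le_refl _)) hj
  exact of_sq_of_sq (ha₁.1.trans (le_of_arrow hxt)) ha₁.2.1 (hx.sq_isJoin_of_arrow hxt hb) hu

/-- Local convexity of the neighborhood of a single point. -/
theorem of_adj_of_adj {x y t u : V} (hx : Γ.DiamondNeighbors x u)
    (hy : Γ.DiamondNeighbors y u) (hne : x ≠ y) (hxt : (metricGraph V).Adj x t)
    (hty : (metricGraph V).Adj t y) : Γ.DiamondNeighbors t u := by
  have hV := Γ.modular
  -- If `t` lies between `u` and `x` or `y`, convexity of order intervals suffices; what remains is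
  -- `t` farther from `u` than both.
  rcases hV.mem_or_mem_of_adj hxt u with hxu | h
  swap
  · rw [metricInterval_comm] at h; exact hx.of_mem h
  rcases hV.mem_or_mem_of_adj hty u with h | hyu
  · rw [metricInterval_comm] at h; exact hy.of_mem h
  rcases (Γ.adj_iff x t).1 hxt with h1 | h1 <;> rcases (Γ.adj_iff t y).1 hty with h2 | h2
  · exact hx.of_arrow_of_arrow hy h1 h2
  · exact hx.of_arrow_to hy hne h1 h2 hxu hyu
  · have := of_arrow_to (Γ := Γ.op) (Γ.op_diamondNeighbors.2 hx) (Γ.op_diamondNeighbors.2 hy) hne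
      h1 h2 hxu hyu
    exact Γ.op_diamondNeighbors.1 this
  · exact hy.of_arrow_of_arrow hx h2 h1

end DiamondNeighbors

/-! ### Neighborhoods of convex sets and balls. -/

variable (Γ) in
/-- The set of all `◇`-neighbors of members of `U`. -/
def diamondNeighborhood (U : Set V) : Set V := {x | ∃ u ∈ U, Γ.DiamondNeighbors x u}

theorem subset_diamondNeighborhood (U : Set V) : U ⊆ Γ.diamondNeighborhood U :=
  fun x hx => ⟨x, hx, .refl x⟩

theorem thickBall_zero (p : V) : Γ.thickBall p 0 = {p} := by
  ext q
  simp [thickBall, eq_comm (a := q)]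

theorem thickBall_succ (p : V) (k : ℕ) :
    Γ.thickBall p (k + 1) = Γ.diamondNeighborhood (Γ.thickBall p k) := by
  ext q
  constructor
  · intro hq
    obtain ⟨w, hw⟩ := SimpleGraph.exists_walk_of_edist_ne_top
      (ne_top_of_le_ne_top (ENat.natCast_ne_top _) hq)
    replace hq : ((w.length : ℕ) : ℕ∞) ≤ ((k + 1 : ℕ) : ℕ∞) := hw ▸ hq
    rw [Nat.cast_le] at hq
    -- Reversing the geodesic exposes its last edge.
    cases hw' : w.reverse with
    | nil => exact ⟨p, by simp [thickBall], .refl p⟩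
    | @cons _ v _ h w' =>
      refine ⟨v, (SimpleGraph.edist_le w'.reverse).trans ?_, h.2⟩
      have : w.reverse.length = w'.length + 1 := by rw [hw']; rfl
      rw [SimpleGraph.Walk.length_reverse] at this ⊢
      exact Nat.cast_le.2 (by omega)
  · rintro ⟨u, hu, h⟩
    have h1 : Γ.thickening.edist u q ≤ 1 := by
      by_cases hq : u = q
      · simp [hq]
      · have hadj : Γ.thickening.Adj u q := ⟨hq, h.symm⟩
        simpa using SimpleGraph.edist_le hadj.toWalk
    refine (SimpleGraph.edist_triangle (v := u)).trans ?_
    push_cast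
    exact add_le_add hu h1

variable [Finite V]

theorem isMetricConvex_diamondNeighborhood {U : Set V} (hU : IsMetricConvex U) :
    IsMetricConvex (Γ.diamondNeighborhood U) := by
  have hV := Γ.modular
  have hgate : ∀ x, U.Nonempty → ∃ g ∈ U, ∀ q ∈ U, dist x q = dist x g + dist g q :=
    fun x hne => (hU.isGated hV hne x).exists
  have hnb : ∀ x ∈ Γ.diamondNeighborhood U, ∀ g ∈ U, (∀ q ∈ U, dist x q = dist x g + dist g q) →
      Γ.DiamondNeighbors x g := by
    rintro x ⟨u, hu, h⟩ g hg hgq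
    have hm : g ∈ metricInterval x u := (hgq u hu).symm
    rw [metricInterval_comm] at hm
    exact (h.symm.of_mem hm).symm
  have hgate' : ∀ x ∈ Γ.diamondNeighborhood U, ∃ g ∈ U, Γ.DiamondNeighbors x g ∧
      metricInterval x g ⊆ Γ.diamondNeighborhood U := by
    rintro x hx
    obtain ⟨g, hg, hgq⟩ := hgate x (hx.imp fun _ h => h.1)
    have h := hnb x hx g hg hgq
    exact ⟨g, hg, h, fun z hz => ⟨g, hg, h.of_mem hz⟩⟩
  refine hV.isMetricConvex_of_local (fun x hx y hy => ?_) fun x hx y hy t hne hxt hty => ?_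
  -- Connectedness: go from `x` to its gate, inside `U` to the gate of `y`, and on to `y`.
  · obtain ⟨x', hx', -, h1⟩ := hgate' x hx
    obtain ⟨y', hy', -, h2⟩ := hgate' y hy
    rw [metricInterval_comm] at h2
    exact ((adj_chain_of_metricInterval_subset h1).trans (adj_chain_of_metricInterval_subset
      ((hU x' hx' y' hy').trans (subset_diamondNeighborhood U)))).trans
      (adj_chain_of_metricInterval_subset h2)
  · have hne' : U.Nonempty := hx.imp fun _ h => h.1
    obtain ⟨x', hx', hxq⟩ := hgate x hne'
    obtain ⟨y', hy', hyq⟩ := hgate y hne'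
    obtain ⟨t', ht', htq⟩ := hgate t hne'
    have h1 := hnb x hx x' hx' hxq
    have h2 := hnb y hy y' hy' hyq
    refine ⟨t', ht', ?_⟩
    by_cases hxt' : x' = t'
    · by_cases hyt' : y' = t'
      · exact (hxt' ▸ h1).of_adj_of_adj (hyt' ▸ h2) hne hxt hty
      · exact h2.of_isLadder (hV.isLadder_gates hty.symm hy' ht' hyq htq hyt')
    · exact h1.of_isLadder (hV.isLadder_gates hxt hx' ht' hxq htq hxt')

theorem isMetricConvex_thickBall (p : V) (k : ℕ) : IsMetricConvex (Γ.thickBall p k) := by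
  induction k with
  | zero =>
    rw [thickBall_zero]
    rintro x rfl y rfl z hz
    exact eq_of_mem_metricInterval_self hz
  | succ k ih =>
    rw [thickBall_succ]
    exact isMetricConvex_diamondNeighborhood ih

end ExtendedModularComplex

theorem mainTheorem10 {V : Type*} [Finite V] [MetricSpace V] (Γ : ExtendedModularComplex V)
    (p : V) (k : ℕ) :
    IsMetricConvex (Γ.thickBall p k) ∧ IsGated (Γ.thickBall p k) := by
  have h := ExtendedModularComplex.isMetricConvex_thickBall (Γ := Γ) p k
  exact ⟨h, h.isGated Γ.modular ⟨p, by simp [ExtendedModularComplex.thickBall]⟩⟩
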